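/- Let $\mathbb K=\mathbb R$ or $\mathbb C$ and let $w$ be the set of all sequences $x=(x_n)_{n\ge0}$ in $\mathbb K$. Let $l_\infty$, $c$, $c_0\subset w$ be the sets of bounded, convergent and null sequences. Let $r,s,t\in w$ with $r_n\ne0$ and $t_n\neq 0$ for all $n\ge 0$, and $s_0\ne0$. For $X\in\{l_\infty,c,c_0\}$ put $$X(r,s,t;\Delta)=\Big\{x\in w:\Big(\frac1{r_n}\sum_{k=0}^n s_{n-k}t_k(x_k-x_{k-1})\Big)_{n\ge0}\in X\Big\},\qquad x_{-1}:=0 .$$ For $U\subset w$ the $\beta$-dual is $U^\beta=\{a\in w:\ \sum_{n=0}^\infty a_nu_n \text{ converges for every } u\in U\}$. Put $D^{(s)}_0=1/s_0$ and, for $n\ge1$, $$D^{(s)}_n=\frac1{s_0^{\,n+1}}\det\big(s_{i-j+1}\big)_{1\le i,j\le n},\qquad s_{p}:=0\ \text{ for } p<0 .$$ For $a\in w$ let $$R_k(a)=\lim_{M\to\infty} r_k\Big[\frac{a_k}{s_0t_k}+\Big(\frac{D^{(s)}_0}{t_k}-\frac{D^{(s)}_1}{t_{k+1}}\Big)\sum_{j=k+1}^{M}a_j+\sum_{l=2}^{M-k}(-1)^l\frac{D^{(s)}_l}{t_{l+k}}\sum_{j=k+l}^{M}a_j\Big]\qquad(k\ge0),$$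 $$w_{mk}=\lim_{M\to\infty} r_k\Big[\sum_{l=0}^{m-k}(-1)^l\frac{D^{(s)}_l}{t_{l+k}}\sum_{j=m}^{M}a_j+\sum_{l=m-k+1}^{M-k}(-1)^l\frac{D^{(s)}_l}{t_{l+k}}\sum_{j=k+l}^{M}a_j\Big]\qquad(0\le k\le m),$$ and $w_{mk}=0$ for $k>m$. (Equivalently, $R_k(a)=\sum_{j=k}^\infty a_js_{jk}$ and $w_{mk}=\sum_{j=m}^\infty a_js_{jk}$ for $k\le m$, where $s_{jk}=r_k\sum_{l=0}^{j-k}(-1)^lD^{(s)}_l/t_{l+k}$ for $k\le j$.) Consider the following sets, where membership in $B_1$ includes that all the $R_k(a)$ exist, and membership in each of $B_2,\dots,B_6$ includes that all the $w_{mk}$ exist (as finite limits): $$\begin{aligned} B_1&=\Big\{a\in w:\sum_{k=0}^\infty|R_k(a)|<\infty\Big\}, & B_2&=\Big\{a\in w:\lim_{m\to\infty}w_{mk}=0\text{ for all }k\Big\},\\ B_3&=\Big\{a\in w:\sup_m\sum_{k=0}^\infty|w_{mk}|<\infty\Big\}, & B_4&=\Big\{a\in w:\lim_{m\to\infty}\sum_{k=0}^m|w_{mk}|=0\Big\},\\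 B_5&=\Big\{a\in w:\lim_{m\to\infty}w_{mk}\text{ exists for all }k\Big\}, & B_6&=\Big\{a\in w:\lim_{m\to\infty}\sum_{k=0}^m w_{mk}\text{ exists}\Big\}. \end{aligned}$$ Then $$[c_0(r,s,t;\Delta)]^\beta=B_1\cap B_2\cap B_3,\qquad [l_\infty(r,s,t;\Delta)]^\beta=B_1\cap B_4,\qquad [c(r,s,t;\Delta)]^\beta=B_1\cap B_3\cap B_5\cap B_6 .$$ -/

import Mathlib

open Filter Topology

namespace GenMeans

variable {𝕜 : Type*} [RCLike 𝕜]

/-- The space of null sequences. -/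
def c0 (𝕜 : Type*) [RCLike 𝕜] : Set (ℕ → 𝕜) := {x | Tendsto x atTop (𝓝 0)}

/-- The space of convergent sequences. -/
def c (𝕜 : Type*) [RCLike 𝕜] : Set (ℕ → 𝕜) := {x | ∃ l, Tendsto x atTop (𝓝 l)}

/-- The space of bounded sequences. -/
def linf (𝕜 : Type*) [RCLike 𝕜] : Set (ℕ → 𝕜) := {x | BddAbove (Set.range fun n => ‖x n‖)}

/-- The space of convergent (not necessarily absolutely convergent) series. -/
def cs (𝕜 : Type*) [RCLike 𝕜] : Set (ℕ → 𝕜) :=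
  {x | ∃ l, Tendsto (fun n => ∑ k ∈ Finset.range n, x k) atTop (𝓝 l)}

/-- The multiplier space of two sets of sequences. -/
def multiplier (U V : Set (ℕ → 𝕜)) : Set (ℕ → 𝕜) := {a | ∀ u ∈ U, (fun n => a n * u n) ∈ V}

/-- The beta-dual of a set of sequences. -/
def betaDual (U : Set (ℕ → 𝕜)) : Set (ℕ → 𝕜) := multiplier U (cs 𝕜)

/-- The backward difference, with the convention that the term of index `-1` is zero. -/
def diff (x : ℕ → 𝕜) : ℕ → 𝕜
  | 0 => x 0
  | k + 1 => x (k + 1) - x k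

/-- The generalized means of a sequence. -/
def genMean (r s t x : ℕ → 𝕜) (n : ℕ) : 𝕜 :=
  1 / r n * ∑ k ∈ Finset.range (n + 1), s (n - k) * t k * x k

/-- The space `X(r, s, t; Δ)`. -/
def space (X : Set (ℕ → 𝕜)) (r s t : ℕ → 𝕜) : Set (ℕ → 𝕜) := {x | genMean r s t (diff x) ∈ X}

/-- The `n × n` Hessenberg matrix with rows `(s₁, s₀, 0, …)`, `(s₂, s₁, s₀, 0, …)`, …,
`(sₙ, …, s₁)`. -/
def hessenberg (s : ℕ → 𝕜) (n : ℕ) : Matrix (Fin n) (Fin n) 𝕜 :=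
  Matrix.of fun i j => if (j : ℕ) ≤ i + 1 then s (i + 1 - j) else 0

/-- The number `Dₙ`; for `n = 0` the determinant is that of the empty matrix, so `D₀ = 1 / s₀`. -/
noncomputable def D (s : ℕ → 𝕜) (n : ℕ) : 𝕜 := 1 / s 0 ^ (n + 1) * (hessenberg s n).det

/-- The expression defining `R_k(a)`, with all the series in it cut off at the index `M` of `a`
(relevant for `k ≤ M`). -/
noncomputable def RTrunc (r s t a : ℕ → 𝕜) (k M : ℕ) : 𝕜 :=
  r k * (a k / (s 0 * t k)
    + (D s 0 / t k - D s 1 / t (k + 1)) * ∑ j ∈ Finset.Icc (k + 1) M, a j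
    + ∑ l ∈ Finset.Icc 2 (M - k),
        (-1) ^ l * (D s l / t (l + k)) * ∑ j ∈ Finset.Icc (k + l) M, a j)

/-- The expression defining `w_{mk}`, `k ≤ m`, with all the series in it cut off at the index `M`
of `a` (relevant for `m ≤ M`). -/
noncomputable def wTrunc (r s t a : ℕ → 𝕜) (m k M : ℕ) : 𝕜 :=
  r k * ((∑ l ∈ Finset.Icc 0 (m - k), (-1) ^ l * (D s l / t (l + k)))
        * (∑ j ∈ Finset.Icc m M, a j)
    + ∑ l ∈ Finset.Icc (m - k + 1) (M - k),
        (-1) ^ l * (D s l / t (l + k)) * ∑ j ∈ Finset.Icc (k + l) M, a j)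

/-- `R_k(a)` exists for every `k`, and `(R_k(a))_k` is the sequence `R`. -/
def IsR (r s t a R : ℕ → 𝕜) : Prop :=
  ∀ k, Tendsto (fun M => RTrunc r s t a k M) atTop (𝓝 (R k))

/-- `w_{mk}` exists for all `k ≤ m`, and `w` is the triangular matrix `(w_{mk})`. -/
def IsW (r s t a : ℕ → 𝕜) (w : ℕ → ℕ → 𝕜) : Prop :=
  (∀ m k, k ≤ m → Tendsto (fun M => wTrunc r s t a m k M) atTop (𝓝 (w m k))) ∧
    ∀ m k, m < k → w m k = 0

def B₁ (r s t : ℕ → 𝕜) : Set (ℕ → 𝕜) :=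
  {a | ∃ R, IsR r s t a R ∧ Summable fun k => ‖R k‖}

def B₂ (r s t : ℕ → 𝕜) : Set (ℕ → 𝕜) :=
  {a | ∃ w, IsW r s t a w ∧ ∀ k, Tendsto (fun m => w m k) atTop (𝓝 0)}

/-- The series over `k` has only finitely many nonzero terms, since `w` is triangular. -/
def B₃ (r s t : ℕ → 𝕜) : Set (ℕ → 𝕜) :=
  {a | ∃ w, IsW r s t a w ∧ BddAbove (Set.range fun m => ∑' k, ‖w m k‖)}

def B₄ (r s t : ℕ → 𝕜) : Set (ℕ → 𝕜) :=
  {a | ∃ w, IsW r s t a w ∧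
    Tendsto (fun m => ∑ k ∈ Finset.range (m + 1), ‖w m k‖) atTop (𝓝 0)}

def B₅ (r s t : ℕ → 𝕜) : Set (ℕ → 𝕜) :=
  {a | ∃ w, IsW r s t a w ∧ ∀ k, ∃ l, Tendsto (fun m => w m k) atTop (𝓝 l)}

def B₆ (r s t : ℕ → 𝕜) : Set (ℕ → 𝕜) :=
  {a | ∃ w, IsW r s t a w ∧
    ∃ l, Tendsto (fun m => ∑ k ∈ Finset.range (m + 1), w m k) atTop (𝓝 l)}

end GenMeans

namespace GenMeans

variable {𝕜 : Type*} [RCLike 𝕜]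

/-! The map from `x` to its generalized mean `y` is a bijection of `w`: convolution with `s` is
undone by convolution with the coefficients `(-1)^n * D s n` of the reciprocal power series, and the
difference by summation. So `x` is the image of `y` under the triangular matrix `kernel`.

Substituting this, the `N`-th partial sum of `∑ a n * x n` becomes `∑ k < N, E N k * y k` with `E =
partialCoeff`. Hence `a` lies in the beta-dual iff the triangular matrix `E` maps `X` into the
convergent sequences. The truncations of `R_k` and `w_{mk}` turn out to be entries of `E` and
differences of such entries, so `R k` is the limit of the `k`-th column and `w m k = R k - E m k`.

What remains is summability theory. Banach–Steinhaus bounds the rows for null sequences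
(`forall_c0_iff`), convergent sequences add the test on the constant sequence 1 (`forall_c_iff`),
and Baire's theorem gives Schur's condition for bounded sequences (`forall_linf_iff`). As `R` is
absolutely summable, each criterion can be stated for `R k - E N k`. Once the `R_k` exist, the
conditions in `B₂` and `B₅` are automatic. -/

/-! ### Hessenberg determinants and the reciprocal power series -/

/-- The Hessenberg matrix of `s` with its first column replaced by `v`. -/
def hessenbergCol (s v : ℕ → 𝕜) (n : ℕ) : Matrix (Fin n) (Fin n) 𝕜 :=
  Matrix.of fun i j => if (j : ℕ) = 0 then v i else hessenberg s n i j

theorem hessenbergCol_shift (s : ℕ → 𝕜) (n : ℕ) :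
    hessenbergCol s (fun i => s (i + 1)) n = hessenberg s n := by
  ext i j
  by_cases h : (j : ℕ) = 0 <;> simp [hessenbergCol, hessenberg, h]

/-- Laplace expansion along the row `(v 0, s 0, 0, …)`. The second minor has the same shape with `v`
shifted, so an arbitrary first column lets the recursion close up. -/
theorem det_hessenbergCol_succ_succ (s v : ℕ → 𝕜) (n : ℕ) :
    (hessenbergCol s v (n + 2)).det =
      v 0 * (hessenberg s (n + 1)).det
        - s 0 * (hessenbergCol s (fun i => v (i + 1)) (n + 1)).det := by
  have h0 : (hessenbergCol s v (n + 2)).submatrix Fin.succ (Fin.succAbove 0) =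
      hessenberg s (n + 1) := by
    ext i j
    simp [hessenbergCol, hessenberg]
  have h1 : (hessenbergCol s v (n + 2)).submatrix Fin.succ (Fin.succAbove 1) =
      hessenbergCol s (fun i => v (i + 1)) (n + 1) := by
    ext i j
    refine Fin.cases ?_ (fun j => ?_) j
    · simp [hessenbergCol]
    · have : Fin.succAbove (1 : Fin (n + 2)) j.succ = j.succ.succ := by
        rw [← Fin.succ_zero_eq_one, Fin.succ_succAbove_succ, Fin.succAbove_zero]
      simp [hessenbergCol, hessenberg, this]
  rw [Matrix.det_succ_row_zero, Fin.sum_univ_succ, Fin.sum_univ_succ,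
    Finset.sum_eq_zero, Fin.succ_zero_eq_one, h0, h1]
  · simp [hessenbergCol, hessenberg]
    ring
  · intro j _
    simp [hessenbergCol, hessenberg]

theorem det_hessenbergCol_succ (s v : ℕ → 𝕜) (n : ℕ) :
    (hessenbergCol s v (n + 1)).det =
      ∑ j ∈ Finset.range (n + 1), (-s 0) ^ j * v j * (hessenberg s (n - j)).det := by
  induction n generalizing v with
  | zero => simp [hessenbergCol]
  | succ n ih =>
    rw [det_hessenbergCol_succ_succ, ih, Finset.sum_range_succ' _ (n + 1), Finset.mul_sum]
    simp only [pow_zero, one_mul, Nat.sub_zero]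
    rw [sub_eq_neg_add, ← Finset.sum_neg_distrib]
    refine congrArg (· + _) (Finset.sum_congr rfl fun j _ => ?_)
    rw [Nat.add_sub_add_right]
    ring

/-- The coefficients of the reciprocal of the power series with coefficients `s`. -/
noncomputable def invCoeff (s : ℕ → 𝕜) (n : ℕ) : 𝕜 := (-1) ^ n * D s n

/-- This is the determinant expansion with `v` the shift of `s`, read as the recursion for the
reciprocal of a power series. -/
theorem invCoeff_succ {s : ℕ → 𝕜} (hs : s 0 ≠ 0) (n : ℕ) :
    s 0 * invCoeff s (n + 1) =
      -∑ j ∈ Finset.range (n + 1), s (j + 1) * invCoeff s (n - j) := by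
  rw [invCoeff, D, ← hessenbergCol_shift, det_hessenbergCol_succ, Finset.mul_sum, Finset.mul_sum,
    Finset.mul_sum, ← Finset.sum_neg_distrib]
  refine Finset.sum_congr rfl fun j hj => ?_
  obtain ⟨p, rfl⟩ := Nat.exists_eq_add_of_le (Nat.lt_succ_iff.mp (Finset.mem_range.mp hj))
  have h1 : ((-1 : 𝕜) ^ j) * (-1) ^ j = 1 := by rw [← mul_pow]; simp
  rw [Nat.add_sub_cancel_left, invCoeff, D, neg_pow]
  field_simp
  linear_combination (-s 0 ^ p * s 0 ^ j * s 0 ^ 2 * s (j + 1) * (hessenberg s p).det * (-1) ^ p) * h1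

open PowerSeries in
theorem mk_mul_mk_invCoeff {s : ℕ → 𝕜} (hs : s 0 ≠ 0) :
    PowerSeries.mk s * PowerSeries.mk (invCoeff s) = 1 := by
  ext n
  rw [coeff_mul, Finset.Nat.sum_antidiagonal_eq_sum_range_succ_mk]
  cases n with
  | zero => simp [invCoeff, D, hessenberg, hs]
  | succ n =>
    rw [Finset.sum_range_succ']
    simp [invCoeff_succ hs, coeff_one]

theorem sum_range_mul_eq_iff {s : ℕ → 𝕜} (hs : s 0 ≠ 0) (u v : ℕ → 𝕜) :
    (∀ n, ∑ k ∈ Finset.range (n + 1), s (n - k) * u k = v n) ↔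
      ∀ n, ∑ k ∈ Finset.range (n + 1), invCoeff s (n - k) * v k = u n := by
  have key (p q : ℕ → 𝕜) (z : ℕ → 𝕜) :
      (∀ n, ∑ k ∈ Finset.range (n + 1), p (n - k) * q k = z n) ↔
        PowerSeries.mk p * PowerSeries.mk q = PowerSeries.mk z := by
    rw [PowerSeries.ext_iff]
    refine forall_congr' fun n => ?_
    rw [mul_comm, PowerSeries.coeff_mul, Finset.Nat.sum_antidiagonal_eq_sum_range_succ_mk]
    simp [mul_comm]
  rw [key, key]
  have h := mk_mul_mk_invCoeff hs
  constructor
  · intro e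
    rw [← e, ← mul_assoc, mul_comm (PowerSeries.mk (invCoeff s)), h, one_mul]
  · intro e
    rw [← e, ← mul_assoc, h, one_mul]

/-! ### Inverting the generalized mean -/

theorem sum_range_diff (x : ℕ → 𝕜) (n : ℕ) : ∑ k ∈ Finset.range (n + 1), diff x k = x n := by
  induction n with
  | zero => simp [diff]
  | succ n ih => rw [Finset.sum_range_succ, ih, diff]; ring

theorem diff_eq_iff (x d : ℕ → 𝕜) :
    (∀ n, diff x n = d n) ↔ ∀ n, x n = ∑ k ∈ Finset.range (n + 1), d k := by
  constructor
  · intro h n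
    rw [← sum_range_diff x n]
    exact Finset.sum_congr rfl fun k _ => h k
  · intro h n
    cases n with
    | zero => simp [diff, h 0]
    | succ n => rw [diff, h, h, Finset.sum_range_succ _ (n + 1)]; ring

/-- The entries of the triangular matrix inverse to the one that maps `x` to
`genMean r s t (diff x)`. -/
noncomputable def kernel (r s t : ℕ → 𝕜) (n k : ℕ) : 𝕜 :=
  r k * ∑ l ∈ Finset.Icc 0 (n - k), (-1) ^ l * (D s l / t (l + k))

/-- The inverse of `x ↦ genMean r s t (diff x)`. -/
noncomputable def invMean (r s t y : ℕ → 𝕜) (n : ℕ) : 𝕜 :=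
  ∑ k ∈ Finset.range (n + 1), kernel r s t n k * y k

/-- Interchanging the sums, with `j = k + l`, shows `invMean` as three successive steps: deconvolve,
divide by `t`, sum up. -/
theorem invMean_eq (r s t y : ℕ → 𝕜) (n : ℕ) :
    invMean r s t y n = ∑ j ∈ Finset.range (n + 1),
      (∑ k ∈ Finset.range (j + 1), invCoeff s (j - k) * (r k * y k)) / t j := by
  simp only [Finset.sum_div]
  rw [Finset.sum_comm' (t' := Finset.range (n + 1)) (s' := fun k => Finset.Ico k (n + 1))
    (by intro j k; simp only [Finset.mem_range, Finset.mem_Ico]; omega)]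
  refine Finset.sum_congr rfl fun k hk => ?_
  have hk : k ≤ n := Nat.lt_succ_iff.mp (Finset.mem_range.mp hk)
  rw [Finset.sum_Ico_eq_sum_range, kernel, Finset.mul_sum, Finset.sum_mul,
    ← Nat.range_succ_eq_Icc_zero, show n + 1 - k = n - k + 1 by omega]
  refine Finset.sum_congr rfl fun l _ => ?_
  rw [Nat.add_sub_cancel_left, invCoeff, add_comm k l]
  ring

theorem genMean_diff_eq_iff {r s t : ℕ → 𝕜} (hr : ∀ n, r n ≠ 0) (hs : s 0 ≠ 0)
    (ht : ∀ n, t n ≠ 0) (x y : ℕ → 𝕜) :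
    genMean r s t (diff x) = y ↔ x = invMean r s t y := by
  have h1 : genMean r s t (diff x) = y ↔
      ∀ n, ∑ k ∈ Finset.range (n + 1), s (n - k) * (t k * diff x k) = r n * y n := by
    rw [funext_iff]
    refine forall_congr' fun n => ?_
    rw [genMean, one_div, inv_mul_eq_iff_eq_mul₀ (hr n)]
    simp only [mul_assoc]
  rw [h1, sum_range_mul_eq_iff hs, funext_iff]
  simp only [invMean_eq]
  rw [← diff_eq_iff]
  refine forall_congr' fun n => ?_
  rw [eq_div_iff (ht n), mul_comm, eq_comm]

/-! ### Partial sums as a triangular matrix transform -/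

/-- The coefficient of `y k` in the `N`-th partial sum of `∑ a n * invMean r s t y n`. -/
noncomputable def partialCoeff (r s t a : ℕ → 𝕜) (N k : ℕ) : 𝕜 :=
  ∑ n ∈ Finset.Ico k N, a n * kernel r s t n k

theorem partialCoeff_of_le (r s t a : ℕ → 𝕜) {N k : ℕ} (h : N ≤ k) :
    partialCoeff r s t a N k = 0 := by
  rw [partialCoeff, Finset.Ico_eq_empty_of_le h, Finset.sum_empty]

theorem sum_mul_invMean (r s t a y : ℕ → 𝕜) (N : ℕ) :
    ∑ n ∈ Finset.range N, a n * invMean r s t y n =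
      ∑ k ∈ Finset.range N, partialCoeff r s t a N k * y k := by
  simp only [invMean, partialCoeff, Finset.mul_sum, Finset.sum_mul]
  rw [Finset.sum_comm' (t' := Finset.range N) (s' := fun k => Finset.Ico k N)
    (by intro j k; simp only [Finset.mem_range, Finset.mem_Ico]; omega)]
  simp only [mul_assoc]

theorem mem_betaDual_space_iff {r s t : ℕ → 𝕜} (hr : ∀ n, r n ≠ 0) (hs : s 0 ≠ 0)
    (ht : ∀ n, t n ≠ 0) (X : Set (ℕ → 𝕜)) (a : ℕ → 𝕜) :
    a ∈ betaDual (space X r s t) ↔ ∀ y ∈ X, ∃ l, Tendsto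
      (fun N => ∑ k ∈ Finset.range N, partialCoeff r s t a N k * y k) atTop (𝓝 l) := by
  simp only [← sum_mul_invMean]
  constructor
  · intro h y hy
    refine h (invMean r s t y) ?_
    rwa [space, Set.mem_ofPred_eq, (genMean_diff_eq_iff hr hs ht _ y).2 rfl]
  · intro h x hx
    obtain ⟨l, hl⟩ := h _ hx
    rw [← (genMean_diff_eq_iff hr hs ht x _).1 rfl] at hl
    exact ⟨l, hl⟩

/-- For `m ≤ n ≤ M`, the inner sum of `kernel r s t n k` splits at `l = m - k`. The lower part does
not depend on `n`; in the upper part the order of summation is exchanged. -/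
theorem wTrunc_eq (r s t a : ℕ → 𝕜) {m k M : ℕ} (hk : k ≤ m) (hM : m ≤ M) :
    wTrunc r s t a m k M = partialCoeff r s t a (M + 1) k - partialCoeff r s t a m k := by
  rw [partialCoeff, partialCoeff, sub_eq_of_eq_add'
    (Finset.sum_Ico_consecutive _ hk (Nat.le_succ_of_le hM)).symm, wTrunc]
  have h : ∀ n ∈ Finset.Ico m M.succ, a n * kernel r s t n k = r k *
      ((∑ l ∈ Finset.Icc 0 (m - k), (-1) ^ l * (D s l / t (l + k))) * a n +
        ∑ l ∈ Finset.Icc (m - k + 1) (n - k), (-1) ^ l * (D s l / t (l + k)) * a n) := by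
    intro n hn
    have hle : m - k + 1 ≤ n - k + 1 := by
      have := (Finset.mem_Ico.mp hn).1
      omega
    rw [kernel, ← Finset.sum_mul, ← add_mul]
    simp only [← Finset.Ico_add_one_right_eq_Icc]
    rw [Finset.sum_Ico_consecutive _ (Nat.zero_le _) hle]
    ring
  rw [Finset.sum_congr rfl h, ← Finset.mul_sum, Finset.sum_add_distrib, ← Finset.mul_sum,
    Finset.sum_comm' (t' := Finset.Icc (m - k + 1) (M - k))
      (s' := fun l => Finset.Icc (k + l) M)
      (by intro n l; simp only [Finset.mem_Icc, Finset.mem_Ico]; omega)]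
  simp only [Finset.mul_sum]
  rfl

/-- `RTrunc` is `wTrunc` with `m = k`, after splitting `a k` off the `l = 0` term and merging the
rest with the `l = 1` term. -/
theorem RTrunc_eq (r s t a : ℕ → 𝕜) {k M : ℕ} (hM : k ≤ M) :
    RTrunc r s t a k M = partialCoeff r s t a (M + 1) k := by
  have h := wTrunc_eq r s t a le_rfl hM
  rw [partialCoeff_of_le r s t a le_rfl, sub_zero] at h
  rw [← h, RTrunc, wTrunc]
  have hD : D s 0 = 1 / s 0 := by simp [D]
  rw [← Finset.add_sum_Ioc_eq_sum_Icc hM, ← Finset.Icc_add_one_left_eq_Ioc, Nat.sub_self]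
  -- For `M = k` there is no `l = 1` term to split off; its counterpart in `RTrunc` carries an empty
  -- sum.
  rcases Nat.eq_or_lt_of_le hM with rfl | hlt
  · simp [hD]
    field_simp
    simp
  · rw [← Finset.add_sum_Ioc_eq_sum_Icc (a := 0 + 1) (b := M - k) (by omega),
      ← Finset.Icc_add_one_left_eq_Ioc]
    simp only [hD, add_comm 1 k, Finset.Icc_self, Finset.sum_singleton, pow_zero, pow_one, zero_add,
      one_mul]
    ring_nf

/-! ### Triangular matrices on null, convergent and bounded sequences -/

theorem exists_norm_le_one_mul_eq_norm (z : 𝕜) : ∃ u : 𝕜, ‖u‖ ≤ 1 ∧ z * u = (‖z‖ : 𝕜) := by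
  obtain ⟨u, hu, h⟩ := RCLike.exists_norm_eq_mul_self z
  exact ⟨u, hu.le, by rw [h, mul_comm]⟩

theorem norm_apply_le_norm_zeroAtInfty (y : ZeroAtInftyContinuousMap ℕ 𝕜) (k : ℕ) :
    ‖y k‖ ≤ ‖y‖ :=
  (y.toBCF.norm_coe_le_norm k).trans_eq ZeroAtInftyContinuousMap.norm_toBCF_eq_norm

/-- The functional `y ↦ ∑ k < N, e k * y k` on the space of null sequences. -/
noncomputable def sumFunctional (e : ℕ → 𝕜) (N : ℕ) : ZeroAtInftyContinuousMap ℕ 𝕜 →L[𝕜] 𝕜 :=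
  LinearMap.mkContinuous
    { toFun := fun y => ∑ k ∈ Finset.range N, e k * y k
      map_add' := fun y z => by simp [mul_add, Finset.sum_add_distrib]
      map_smul' := fun b y => by simp [Finset.mul_sum, mul_left_comm] }
    (∑ k ∈ Finset.range N, ‖e k‖) fun y => by
      change ‖∑ k ∈ Finset.range N, e k * y k‖ ≤ _
      rw [Finset.sum_mul]
      refine (norm_sum_le _ _).trans (Finset.sum_le_sum fun k _ => ?_)
      rw [norm_mul]
      gcongr
      exact norm_apply_le_norm_zeroAtInfty y k

/-- Tested on the conjugate phases of `e`, cut off at `N` so that the test sequence is null. -/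
theorem sum_norm_le_norm_sumFunctional (e : ℕ → 𝕜) (N : ℕ) :
    ∑ k ∈ Finset.range N, ‖e k‖ ≤ ‖sumFunctional e N‖ := by
  choose u hu hue using fun k => exists_norm_le_one_mul_eq_norm (e k)
  have hz : Tendsto (fun k => if k < N then u k else 0) (cocompact ℕ) (𝓝 0) := by
    rw [cocompact_eq_atTop]
    refine tendsto_const_nhds.congr' ?_
    filter_upwards [eventually_ge_atTop N] with k hk
    rw [if_neg (not_lt.mpr hk)]
  let y : ZeroAtInftyContinuousMap ℕ 𝕜 :=
    ⟨⟨fun k => if k < N then u k else 0, continuous_of_discreteTopology⟩, hz⟩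
  have hy : ‖y‖ ≤ 1 := by
    rw [← ZeroAtInftyContinuousMap.norm_toBCF_eq_norm]
    refine (BoundedContinuousFunction.norm_le zero_le_one).2 fun k => ?_
    change ‖if k < N then u k else 0‖ ≤ 1
    split_ifs
    · exact hu k
    · simp
  have h : sumFunctional e N y = ((∑ k ∈ Finset.range N, ‖e k‖ : ℝ) : 𝕜) := by
    change ∑ k ∈ Finset.range N, e k * (if k < N then u k else 0) = _
    push_cast
    refine Finset.sum_congr rfl fun k hk => ?_
    rw [if_pos (Finset.mem_range.mp hk), hue]
  calc ∑ k ∈ Finset.range N, ‖e k‖ = ‖sumFunctional e N y‖ := by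
        rw [h, RCLike.norm_ofReal, abs_of_nonneg (Finset.sum_nonneg fun k _ => norm_nonneg _)]
    _ ≤ ‖sumFunctional e N‖ := ContinuousLinearMap.unit_le_opNorm _ _ hy

theorem exists_norm_le_of_tendsto {f : ℕ → 𝕜} {l : 𝕜} (h : Tendsto f atTop (𝓝 l)) :
    ∃ C, ∀ n, ‖f n‖ ≤ C := by
  obtain ⟨C, hC⟩ := h.norm.bddAbove_range
  exact ⟨C, fun n => hC ⟨n, rfl⟩⟩

theorem c0_subset_c : c0 𝕜 ⊆ c 𝕜 := fun _ hy => ⟨0, hy⟩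

theorem c_subset_linf : c 𝕜 ⊆ linf 𝕜 := fun _ ⟨_, hl⟩ => hl.norm.bddAbove_range

/-- Uniform boundedness: convergent sums are bounded for each `y`, hence the functionals are bounded
in norm. -/
theorem exists_sum_norm_le_of_c0 {E : ℕ → ℕ → 𝕜}
    (h : ∀ y ∈ c0 𝕜, ∃ l, Tendsto (fun N => ∑ k ∈ Finset.range N, E N k * y k) atTop (𝓝 l)) :
    ∃ C, ∀ N, ∑ k ∈ Finset.range N, ‖E N k‖ ≤ C := by
  obtain ⟨C, hC⟩ := banach_steinhaus (g := fun N => sumFunctional (E N) N) fun y => by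
    have hy := y.zero_at_infty'
    rw [cocompact_eq_atTop] at hy
    obtain ⟨l, hl⟩ := h y hy
    exact exists_norm_le_of_tendsto hl
  exact ⟨C, fun N => (sum_norm_le_norm_sumFunctional _ _).trans (hC N)⟩

theorem exists_tendsto_entries_of_c0 {E : ℕ → ℕ → 𝕜}
    (h : ∀ y ∈ c0 𝕜, ∃ l, Tendsto (fun N => ∑ k ∈ Finset.range N, E N k * y k) atTop (𝓝 l)) :
    ∃ R : ℕ → 𝕜, ∀ k, Tendsto (fun N => E N k) atTop (𝓝 (R k)) := by
  refine Classical.axiomOfChoice (r := fun k l => Tendsto (fun N => E N k) atTop (𝓝 l))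
    fun k => ?_
  obtain ⟨l, hl⟩ := h (Pi.single k 1) (tendsto_const_nhds.congr' (by
    filter_upwards [eventually_gt_atTop k] with n hn
    rw [Pi.single_eq_of_ne hn.ne']))
  refine ⟨l, hl.congr' ?_⟩
  filter_upwards [eventually_gt_atTop k] with N hN
  rw [Finset.sum_eq_single_of_mem k (Finset.mem_range.mpr hN)
    (fun j _ hj => by rw [Pi.single_eq_of_ne hj, mul_zero]), Pi.single_eq_same, mul_one]

theorem sum_norm_le_of_tendsto {E : ℕ → ℕ → 𝕜} {R : ℕ → 𝕜}
    (hR : ∀ k, Tendsto (fun N => E N k) atTop (𝓝 (R k))) {C : ℝ} {S : Finset ℕ}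
    (hC : ∀ᶠ N in atTop, ∑ k ∈ S, ‖E N k‖ ≤ C) : ∑ k ∈ S, ‖R k‖ ≤ C :=
  le_of_tendsto (tendsto_finsetSum _ fun k _ => (hR k).norm) hC

theorem summable_norm_of_tendsto {E : ℕ → ℕ → 𝕜} {R : ℕ → 𝕜}
    (hR : ∀ k, Tendsto (fun N => E N k) atTop (𝓝 (R k))) {C : ℝ}
    (hC : ∀ N, ∑ k ∈ Finset.range N, ‖E N k‖ ≤ C) : Summable fun k => ‖R k‖ := by
  refine summable_of_sum_range_le (fun _ => norm_nonneg _) (c := C) fun n =>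
    sum_norm_le_of_tendsto hR ?_
  filter_upwards [eventually_ge_atTop n] with N hN
  exact (Finset.sum_le_sum_of_subset_of_nonneg (Finset.range_subset_range.2 hN)
    fun _ _ _ => norm_nonneg _).trans (hC N)

/-- If bounded rows tend to zero entrywise, then they map null sequences to null sequences. -/
theorem tendsto_sum_mul_zero {W : ℕ → ℕ → 𝕜} {C : ℝ}
    (hC : ∀ N, ∑ k ∈ Finset.range (N + 1), ‖W N k‖ ≤ C)
    (hW : ∀ k, Tendsto (fun N => W N k) atTop (𝓝 0)) {y : ℕ → 𝕜} (hy : Tendsto y atTop (𝓝 0)) :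
    Tendsto (fun N => ∑ k ∈ Finset.range (N + 1), W N k * y k) atTop (𝓝 0) := by
  rw [Metric.tendsto_atTop]
  intro ε hε
  have hC0 : 0 ≤ C := (Finset.sum_nonneg fun _ _ => norm_nonneg _).trans (hC 0)
  -- The `+ 1` covers `C = 0` and makes the tail bound `C * δ < ε / 2` strict.
  have hδ : 0 < ε / (2 * (C + 1)) := by positivity
  obtain ⟨K, hK⟩ := Metric.tendsto_atTop.mp hy _ hδ
  have hhead : Tendsto (fun N => ∑ k ∈ Finset.range K, ‖W N k * y k‖) atTop (𝓝 0) := by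
    have := tendsto_finsetSum (Finset.range K) fun k _ => ((hW k).mul_const (y k)).norm
    simpa using this
  obtain ⟨N₀, hN₀⟩ := eventually_atTop.mp (hhead.eventually_lt_const (half_pos hε))
  refine ⟨max N₀ K, fun N hN => ?_⟩
  have hKN : K ≤ N + 1 := ((le_max_right _ _).trans hN).trans (Nat.le_succ N)
  rw [dist_zero_right, ← Finset.sum_range_add_sum_Ico _ hKN]
  have htail : ∑ k ∈ Finset.Ico K (N + 1), ‖W N k * y k‖ ≤ C * (ε / (2 * (C + 1))) := by
    calc ∑ k ∈ Finset.Ico K (N + 1), ‖W N k * y k‖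
        ≤ ∑ k ∈ Finset.Ico K (N + 1), ‖W N k‖ * (ε / (2 * (C + 1))) := by
          refine Finset.sum_le_sum fun k hk => ?_
          rw [norm_mul]
          gcongr
          have := hK k (Finset.mem_Ico.mp hk).1
          rw [dist_zero_right] at this
          exact this.le
      _ ≤ _ := by
          rw [← Finset.sum_mul]
          gcongr
          refine (Finset.sum_le_sum_of_subset_of_nonneg ?_ fun _ _ _ => norm_nonneg _).trans (hC N)
          intro k hk
          exact Finset.mem_range.mpr (Finset.mem_Ico.mp hk).2
  have hlt : C * (ε / (2 * (C + 1))) < ε / 2 := by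
    rw [mul_div_assoc', div_lt_div_iff₀ (by positivity) two_pos]
    nlinarith
  calc _ ≤ ∑ k ∈ Finset.range K, ‖W N k * y k‖ + ∑ k ∈ Finset.Ico K (N + 1), ‖W N k * y k‖ :=
        (norm_add_le _ _).trans (add_le_add (norm_sum_le _ _) (norm_sum_le _ _))
    _ < ε / 2 + ε / 2 := add_lt_add (hN₀ N ((le_max_left _ _).trans hN)) (htail.trans_lt hlt)
    _ = ε := add_halves ε

theorem summable_mul_of_mem_linf {R y : ℕ → 𝕜} (hR : Summable fun k => ‖R k‖) (hy : y ∈ linf 𝕜) :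
    Summable fun k => R k * y k := by
  obtain ⟨C, hC⟩ := hy
  refine Summable.of_norm_bounded (hR.mul_right C) fun k => ?_
  rw [norm_mul]
  gcongr
  exact hC ⟨k, rfl⟩

/-- For rows given by a triangular matrix `E`, the convergence of `∑ E N k * y k` amounts to that
of the sums with the entries `R k - E N k`. -/
theorem exists_tendsto_iff_sub {E : ℕ → ℕ → 𝕜} (hE : ∀ N, E N N = 0) {R y : ℕ → 𝕜}
    (hR : Summable fun k => ‖R k‖) (hy : y ∈ linf 𝕜) :
    (∃ l, Tendsto (fun N => ∑ k ∈ Finset.range N, E N k * y k) atTop (𝓝 l)) ↔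
      ∃ l, Tendsto (fun N => ∑ k ∈ Finset.range (N + 1), (R k - E N k) * y k) atTop (𝓝 l) := by
  have hs : Tendsto (fun N => ∑ k ∈ Finset.range (N + 1), R k * y k) atTop
      (𝓝 (∑' k, R k * y k)) :=
    (tendsto_add_atTop_iff_nat 1).2 (summable_mul_of_mem_linf hR hy).hasSum.tendsto_sum_nat
  have h (N : ℕ) : ∑ k ∈ Finset.range (N + 1), (R k - E N k) * y k =
      ∑ k ∈ Finset.range (N + 1), R k * y k - ∑ k ∈ Finset.range N, E N k * y k := by
    simp only [sub_mul, Finset.sum_sub_distrib]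
    rw [Finset.sum_range_succ (fun k => E N k * y k), hE, zero_mul, add_zero]
  simp only [h]
  constructor
  · rintro ⟨l, hl⟩
    exact ⟨_, hs.sub hl⟩
  · rintro ⟨l, hl⟩
    exact ⟨_, (hs.sub hl).congr fun N => sub_sub_cancel _ _⟩

/-- Unit sequences give the column limits; the uniform row bound passes to `R`, so the rows of `R -
E` are bounded by the triangle inequality. -/
theorem exists_limit_of_c0 {E : ℕ → ℕ → 𝕜} (hE : ∀ N, E N N = 0)
    (h : ∀ y ∈ c0 𝕜, ∃ l, Tendsto (fun N => ∑ k ∈ Finset.range N, E N k * y k) atTop (𝓝 l)) :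
    ∃ R : ℕ → 𝕜, (∀ k, Tendsto (fun N => E N k) atTop (𝓝 (R k))) ∧ (Summable fun k => ‖R k‖) ∧
      BddAbove (Set.range fun N => ∑ k ∈ Finset.range (N + 1), ‖R k - E N k‖) := by
  obtain ⟨C, hC⟩ := exists_sum_norm_le_of_c0 h
  obtain ⟨R, hR⟩ := exists_tendsto_entries_of_c0 h
  have hs := summable_norm_of_tendsto hR hC
  refine ⟨R, hR, hs, ∑' k, ‖R k‖ + C, ?_⟩
  rintro _ ⟨N, rfl⟩
  calc ∑ k ∈ Finset.range (N + 1), ‖R k - E N k‖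
      ≤ ∑ k ∈ Finset.range (N + 1), (‖R k‖ + ‖E N k‖) :=
        Finset.sum_le_sum fun k _ => norm_sub_le _ _
    _ ≤ _ := by
      rw [Finset.sum_add_distrib, Finset.sum_range_succ (fun k => ‖E N k‖), hE, norm_zero,
        add_zero]
      exact add_le_add (hs.sum_le_tsum _ fun _ _ => norm_nonneg _) (hC N)

theorem tendsto_sum_sub_mul_zero {E : ℕ → ℕ → 𝕜} {R : ℕ → 𝕜}
    (hR : ∀ k, Tendsto (fun N => E N k) atTop (𝓝 (R k)))
    (hC : BddAbove (Set.range fun N => ∑ k ∈ Finset.range (N + 1), ‖R k - E N k‖))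
    {y : ℕ → 𝕜} (hy : Tendsto y atTop (𝓝 0)) :
    Tendsto (fun N => ∑ k ∈ Finset.range (N + 1), (R k - E N k) * y k) atTop (𝓝 0) := by
  obtain ⟨C, hC⟩ := hC
  refine tendsto_sum_mul_zero (fun N => hC ⟨N, rfl⟩) (fun k => ?_) hy
  simpa using (tendsto_const_nhds (x := R k)).sub (hR k)

/-- Triangular matrices that map null sequences to convergent ones. -/
theorem forall_c0_iff {E : ℕ → ℕ → 𝕜} (hE : ∀ N, E N N = 0) :
    (∀ y ∈ c0 𝕜, ∃ l, Tendsto (fun N => ∑ k ∈ Finset.range N, E N k * y k) atTop (𝓝 l)) ↔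
    ∃ R : ℕ → 𝕜, (∀ k, Tendsto (fun N => E N k) atTop (𝓝 (R k))) ∧ (Summable fun k => ‖R k‖) ∧
      BddAbove (Set.range fun N => ∑ k ∈ Finset.range (N + 1), ‖R k - E N k‖) := by
  refine ⟨exists_limit_of_c0 hE, ?_⟩
  rintro ⟨R, hR, hs, hC⟩ y hy
  exact (exists_tendsto_iff_sub hE hs (c_subset_linf (c0_subset_c hy))).2
    ⟨0, tendsto_sum_sub_mul_zero hR hC hy⟩

/-- Triangular matrices that map convergent sequences to convergent ones. -/
theorem forall_c_iff {E : ℕ → ℕ → 𝕜} (hE : ∀ N, E N N = 0) :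
    (∀ y ∈ c 𝕜, ∃ l, Tendsto (fun N => ∑ k ∈ Finset.range N, E N k * y k) atTop (𝓝 l)) ↔
    ∃ R : ℕ → 𝕜, (∀ k, Tendsto (fun N => E N k) atTop (𝓝 (R k))) ∧ (Summable fun k => ‖R k‖) ∧
      BddAbove (Set.range fun N => ∑ k ∈ Finset.range (N + 1), ‖R k - E N k‖) ∧
      ∃ l, Tendsto (fun N => ∑ k ∈ Finset.range (N + 1), (R k - E N k)) atTop (𝓝 l) := by
  constructor
  · intro h
    obtain ⟨R, hR, hs, hC⟩ := exists_limit_of_c0 hE fun y hy => h y (c0_subset_c hy)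
    have h1 : (fun _ => 1 : ℕ → 𝕜) ∈ c 𝕜 := ⟨1, tendsto_const_nhds⟩
    have := (exists_tendsto_iff_sub hE hs (c_subset_linf h1)).1 (h _ h1)
    simp only [mul_one] at this
    exact ⟨R, hR, hs, hC, this⟩
  · rintro ⟨R, hR, hs, hC, l, hl⟩ y hy
    refine (exists_tendsto_iff_sub hE hs (c_subset_linf hy)).2 ?_
    obtain ⟨p, hp⟩ := hy
    have hp0 : Tendsto (fun k => y k - p) atTop (𝓝 0) := by
      simpa using hp.sub (tendsto_const_nhds (x := p))
    -- Split `y = (y - p) + p`: the null part contributes 0, the constant part `p` times the limit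
    -- of the row sums.
    refine ⟨0 + l * p, ((tendsto_sum_sub_mul_zero hR hC hp0).add (hl.mul_const p)).congr
      fun N => ?_⟩
    rw [Finset.sum_mul, ← Finset.sum_add_distrib]
    refine Finset.sum_congr rfl fun k _ => ?_
    ring

/-- By Baire's theorem on the product of unit balls, convergence of the sums for all bounded `y`
is uniform away from finitely many entries. -/
theorem exists_sum_norm_sub_le_of_linf {E : ℕ → ℕ → 𝕜} (hE : ∀ N k, N ≤ k → E N k = 0)
    (h : ∀ y ∈ linf 𝕜, ∃ l, Tendsto (fun N => ∑ k ∈ Finset.range N, E N k * y k) atTop (𝓝 l))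
    {ε : ℝ} (hε : 0 < ε) :
    ∃ (I : Finset ℕ) (m : ℕ), ∀ p ≥ m, ∀ q ≥ m, ∀ S : Finset ℕ, Disjoint S I →
      ∑ k ∈ S, ‖E p k - E q k‖ ≤ ε := by
  -- In the product topology the space of sequences in the unit ball is compact Hausdorff, so Baire
  -- applies, and each `f N` is continuous because it involves finitely many coordinates.
  let f : ℕ → (ℕ → Metric.closedBall (0 : 𝕜) 1) → 𝕜 :=
    fun N y => ∑ k ∈ Finset.range N, E N k * y k
  have hf (N : ℕ) : Continuous (f N) := by fun_prop
  let F : ℕ → Set (ℕ → Metric.closedBall (0 : 𝕜) 1) :=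
    fun m => {y | ∀ p ≥ m, ∀ q ≥ m, dist (f p y) (f q y) ≤ ε / 2}
  have hF (m : ℕ) : IsClosed (F m) := by
    simp only [F, Set.ofPred_forall]
    exact isClosed_iInter fun p => isClosed_iInter fun _ => isClosed_iInter fun q =>
      isClosed_iInter fun _ => isClosed_le ((hf p).dist (hf q)) continuous_const
  have hU : ⋃ m, F m = Set.univ := by
    refine Set.eq_univ_of_forall fun y => Set.mem_iUnion.mpr ?_
    obtain ⟨l, hl⟩ := h (fun k => y k) ⟨1, by
      rintro _ ⟨k, rfl⟩
      exact mem_closedBall_zero_iff.mp (y k).2⟩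
    obtain ⟨m, hm⟩ := Metric.cauchySeq_iff.mp hl.cauchySeq (ε / 2) (half_pos hε)
    exact ⟨m, fun p hp q hq => (hm p hp q hq).le⟩
  obtain ⟨m, y₀, hy₀⟩ := nonempty_interior_of_iUnion_of_closed hF hU
  -- A basic open set constrains only the coordinates in a finite `I`; off `I` the points of `F m`
  -- are arbitrary.
  obtain ⟨I, u, hu, hI⟩ := isOpen_pi_iff.mp isOpen_interior y₀ hy₀
  have hmem (y : ℕ → Metric.closedBall (0 : 𝕜) 1) (hy : ∀ k ∈ I, y k = y₀ k) : y ∈ F m :=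
    interior_subset (hI fun k hk => by rw [hy k hk]; exact (hu k hk).2)
  refine ⟨I, m, fun p hp q hq S hS => ?_⟩
  choose v hv hve using fun k => exists_norm_le_one_mul_eq_norm (E p k - E q k)
  -- `y₁` and `y₂` agree off `S`, so subtracting their `f p - f q` isolates the sum over `S`, where
  -- the phases `v` turn it into a sum of norms.
  let y₁ : ℕ → Metric.closedBall (0 : 𝕜) 1 := fun k =>
    if k ∈ S then ⟨v k, mem_closedBall_zero_iff.mpr (hv k)⟩ else y₀ k
  let y₂ : ℕ → Metric.closedBall (0 : 𝕜) 1 := fun k =>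
    if k ∈ S then ⟨0, by simp⟩ else y₀ k
  have hSI (k : ℕ) (hk : k ∈ I) : k ∉ S := fun hkS => Finset.disjoint_left.mp hS hkS hk
  have h₁ := hmem y₁ (fun k hk => if_neg (hSI k hk)) p hp q hq
  have h₂ := hmem y₂ (fun k hk => if_neg (hSI k hk)) p hp q hq
  have hext (N n : ℕ) (hn : N ≤ n) (y : ℕ → Metric.closedBall (0 : 𝕜) 1) :
      f N y = ∑ k ∈ Finset.range n, E N k * y k :=
    Finset.sum_subset (Finset.range_subset_range.2 hn) fun k _ hk => by
      rw [hE N k (not_lt.mp fun hlt => hk (Finset.mem_range.mpr hlt)), zero_mul]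
  obtain ⟨n, hn⟩ := Finset.exists_nat_subset_range (S ∪ Finset.range (max p q))
  have hpq : max p q ≤ n := Finset.range_subset_range.1 (Finset.subset_union_right.trans hn)
  have hkey : ((∑ k ∈ S, ‖E p k - E q k‖ : ℝ) : 𝕜) =
      (f p y₁ - f q y₁) - (f p y₂ - f q y₂) := by
    rw [hext p n ((le_max_left _ _).trans hpq), hext q n ((le_max_right _ _).trans hpq),
      hext p n ((le_max_left _ _).trans hpq), hext q n ((le_max_right _ _).trans hpq),
      ← Finset.sum_sub_distrib, ← Finset.sum_sub_distrib, ← Finset.sum_sub_distrib]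
    push_cast
    rw [← Finset.sum_subset (Finset.subset_union_left.trans hn)]
    · refine Finset.sum_congr rfl fun k hk => ?_
      simp only [y₁, y₂, if_pos hk]
      refine (hve k).symm.trans ?_
      ring
    · intro k _ hk
      simp only [y₁, y₂, if_neg hk]
      ring
  rw [dist_eq_norm] at h₁ h₂
  calc ∑ k ∈ S, ‖E p k - E q k‖ = ‖((∑ k ∈ S, ‖E p k - E q k‖ : ℝ) : 𝕜)‖ := by
        rw [RCLike.norm_ofReal, abs_of_nonneg (Finset.sum_nonneg fun k _ => norm_nonneg _)]
    _ ≤ ε / 2 + ε / 2 := by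
        rw [hkey]
        exact (norm_sub_le _ _).trans (add_le_add h₁ h₂)
    _ = ε := add_halves ε

/-- Schur's theorem: triangular matrices that map bounded sequences to convergent ones. -/
theorem forall_linf_iff {E : ℕ → ℕ → 𝕜} (hE : ∀ N k, N ≤ k → E N k = 0) :
    (∀ y ∈ linf 𝕜, ∃ l, Tendsto (fun N => ∑ k ∈ Finset.range N, E N k * y k) atTop (𝓝 l)) ↔
    ∃ R : ℕ → 𝕜, (∀ k, Tendsto (fun N => E N k) atTop (𝓝 (R k))) ∧ (Summable fun k => ‖R k‖) ∧
      Tendsto (fun N => ∑ k ∈ Finset.range (N + 1), ‖R k - E N k‖) atTop (𝓝 0) := by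
  have hE' (N : ℕ) : E N N = 0 := hE N N le_rfl
  constructor
  · intro h
    obtain ⟨R, hR, hs, -⟩ :=
      exists_limit_of_c0 hE' fun y hy => h y (c_subset_linf (c0_subset_c hy))
    refine ⟨R, hR, hs, ?_⟩
    have hW (k : ℕ) : Tendsto (fun N => ‖R k - E N k‖) atTop (𝓝 0) := by
      simpa using ((tendsto_const_nhds (x := R k)).sub (hR k)).norm
    rw [Metric.tendsto_atTop]
    intro ε hε
    obtain ⟨I, m, hm⟩ := exists_sum_norm_sub_le_of_linf hE h (half_pos hε)
    have hhead : Tendsto (fun N => ∑ k ∈ I, ‖R k - E N k‖) atTop (𝓝 0) := by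
      simpa using tendsto_finsetSum I fun k _ => hW k
    obtain ⟨N₀, hN₀⟩ := eventually_atTop.mp (hhead.eventually_lt_const (half_pos hε))
    refine ⟨max N₀ m, fun N hN => ?_⟩
    have htail : ∑ k ∈ Finset.range (N + 1) \ I, ‖R k - E N k‖ ≤ ε / 2 := by
      -- Let `q` tend to infinity in the uniform bound, with `N` fixed.
      refine sum_norm_le_of_tendsto (E := fun q k => E q k - E N k)
        (fun k => (hR k).sub tendsto_const_nhds) ?_
      filter_upwards [eventually_ge_atTop m] with q hq
      exact hm q hq N ((le_max_right _ _).trans hN) _ Finset.sdiff_disjoint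
    rw [dist_zero_right, Real.norm_of_nonneg (Finset.sum_nonneg fun _ _ => norm_nonneg _)]
    calc ∑ k ∈ Finset.range (N + 1), ‖R k - E N k‖
        ≤ ∑ k ∈ (Finset.range (N + 1) \ I) ∪ I, ‖R k - E N k‖ :=
          Finset.sum_le_sum_of_subset_of_nonneg
            (by rw [Finset.sdiff_union_self_eq_union]; exact Finset.subset_union_left)
            fun _ _ _ => norm_nonneg _
      _ = ∑ k ∈ Finset.range (N + 1) \ I, ‖R k - E N k‖ + ∑ k ∈ I, ‖R k - E N k‖ :=
          Finset.sum_union Finset.sdiff_disjoint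
      _ < ε / 2 + ε / 2 := add_lt_add_of_le_of_lt htail (hN₀ N ((le_max_left _ _).trans hN))
      _ = ε := add_halves ε
  · rintro ⟨R, hR, hs, hW⟩ y hy
    refine (exists_tendsto_iff_sub hE' hs hy).2 ⟨0, ?_⟩
    obtain ⟨C, hC⟩ := hy
    refine squeeze_zero_norm (fun N => ?_) (by simpa using hW.mul_const C)
    rw [Finset.sum_mul]
    refine norm_sum_le_of_le _ fun k _ => ?_
    rw [norm_mul]
    gcongr
    exact hC ⟨k, rfl⟩

/-! ### Rewriting the sets `B₁`, …, `B₆` through `R - E` -/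

theorem isR_iff (r s t a R : ℕ → 𝕜) :
    IsR r s t a R ↔ ∀ k, Tendsto (fun N => partialCoeff r s t a N k) atTop (𝓝 (R k)) := by
  refine forall_congr' fun k => ?_
  -- The truncation at `M` includes the index `M`, so it corresponds to the partial sum `N = M + 1`.
  rw [← tendsto_add_atTop_iff_nat (f := fun N => partialCoeff r s t a N k) 1]
  refine tendsto_congr' ?_
  filter_upwards [eventually_ge_atTop k] with M hM
  exact RTrunc_eq r s t a hM

theorem isW_iff {r s t a R : ℕ → 𝕜} (hR : IsR r s t a R) (w : ℕ → ℕ → 𝕜) :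
    IsW r s t a w ↔
      w = fun m k => if k ≤ m then R k - partialCoeff r s t a m k else 0 := by
  have hlim (m k : ℕ) (hk : k ≤ m) : Tendsto (fun M => wTrunc r s t a m k M) atTop
      (𝓝 (R k - partialCoeff r s t a m k)) := by
    refine (((tendsto_add_atTop_iff_nat 1).2 ((isR_iff r s t a R).1 hR k)).sub
      tendsto_const_nhds).congr' ?_
    filter_upwards [eventually_ge_atTop m] with M hM
    exact (wTrunc_eq r s t a hk hM).symm
  constructor
  · intro h
    ext m k
    split_ifs with hk
    · exact tendsto_nhds_unique (h.1 m k hk) (hlim m k hk)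
    · exact h.2 m k (not_le.mp hk)
  · rintro rfl
    refine ⟨fun m k hk => ?_, fun m k hk => if_neg (not_le.mpr hk)⟩
    simpa only [if_pos hk] using hlim m k hk

/-- Limits are unique, so `R` determines `w` and the existential in each of `B₂`, …, `B₆` collapses.
-/
theorem exists_isW_and_iff {r s t a R : ℕ → 𝕜} (hR : IsR r s t a R) (P : (ℕ → ℕ → 𝕜) → Prop) :
    (∃ w, IsW r s t a w ∧ P w) ↔
      P fun m k => if k ≤ m then R k - partialCoeff r s t a m k else 0 := by
  simp only [isW_iff hR, exists_eq_left]

theorem sum_range_succ_ite_le {M : Type*} [AddCommMonoid M] (f : ℕ → M) (m : ℕ) :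
    ∑ k ∈ Finset.range (m + 1), (if k ≤ m then f k else 0) = ∑ k ∈ Finset.range (m + 1), f k :=
  Finset.sum_congr rfl fun _ hk => if_pos (Nat.lt_succ_iff.mp (Finset.mem_range.mp hk))

theorem mem_B₁_inter_iff (r s t a : ℕ → 𝕜) (S : Set (ℕ → 𝕜)) :
    a ∈ B₁ r s t ∩ S ↔ ∃ R, IsR r s t a R ∧ (Summable fun k => ‖R k‖) ∧ a ∈ S := by
  constructor
  · rintro ⟨⟨R, hR, hs⟩, hS⟩
    exact ⟨R, hR, hs, hS⟩
  · rintro ⟨R, hR, hs, hS⟩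
    exact ⟨⟨R, hR, hs⟩, hS⟩

/-- For fixed `k`, `w_{mk}` is a tail of the convergent series for `R_k`, hence tends to 0. -/
theorem mem_B₂ {r s t a R : ℕ → 𝕜} (hR : IsR r s t a R) : a ∈ B₂ r s t := by
  refine (exists_isW_and_iff hR fun w => ∀ k, Tendsto (fun m => w m k) atTop (𝓝 0)).2 fun k => ?_
  have h : Tendsto (fun m => R k - partialCoeff r s t a m k) atTop (𝓝 0) := by
    simpa using (tendsto_const_nhds (x := R k)).sub ((isR_iff r s t a R).1 hR k)
  refine h.congr' ?_
  filter_upwards [eventually_ge_atTop k] with m hm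
  rw [if_pos hm]

theorem B₂_subset_B₅ (r s t : ℕ → 𝕜) : B₂ r s t ⊆ B₅ r s t :=
  fun _ ⟨w, hw, h⟩ => ⟨w, hw, fun k => ⟨0, h k⟩⟩

theorem mem_B₃_iff {r s t a R : ℕ → 𝕜} (hR : IsR r s t a R) :
    a ∈ B₃ r s t ↔ BddAbove
      (Set.range fun m => ∑ k ∈ Finset.range (m + 1), ‖R k - partialCoeff r s t a m k‖) := by
  refine (exists_isW_and_iff hR fun w => BddAbove (Set.range fun m => ∑' k, ‖w m k‖)).trans ?_
  have h (m : ℕ) : ∑' k, ‖if k ≤ m then R k - partialCoeff r s t a m k else 0‖ =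
      ∑ k ∈ Finset.range (m + 1), ‖R k - partialCoeff r s t a m k‖ := by
    simp only [apply_ite norm, norm_zero]
    rw [tsum_eq_sum (s := Finset.range (m + 1)), sum_range_succ_ite_le]
    intro k hk
    exact if_neg fun hle => hk (Finset.mem_range.mpr (Nat.lt_succ_iff.mpr hle))
  simp only [h]

theorem mem_B₄_iff {r s t a R : ℕ → 𝕜} (hR : IsR r s t a R) :
    a ∈ B₄ r s t ↔ Tendsto
      (fun m => ∑ k ∈ Finset.range (m + 1), ‖R k - partialCoeff r s t a m k‖) atTop (𝓝 0) := by
  refine (exists_isW_and_iff hR fun w =>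
    Tendsto (fun m => ∑ k ∈ Finset.range (m + 1), ‖w m k‖) atTop (𝓝 0)).trans ?_
  simp only [apply_ite norm, norm_zero, sum_range_succ_ite_le]

theorem mem_B₆_iff {r s t a R : ℕ → 𝕜} (hR : IsR r s t a R) :
    a ∈ B₆ r s t ↔ ∃ l, Tendsto
      (fun m => ∑ k ∈ Finset.range (m + 1), (R k - partialCoeff r s t a m k)) atTop (𝓝 l) := by
  refine (exists_isW_and_iff hR fun w =>
    ∃ l, Tendsto (fun m => ∑ k ∈ Finset.range (m + 1), w m k) atTop (𝓝 l)).trans ?_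
  simp only [sum_range_succ_ite_le]

end GenMeans

theorem theorem4p8 {𝕜 : Type*} [RCLike 𝕜] (r s t : ℕ → 𝕜)
    (hr : ∀ n, r n ≠ 0) (hs : s 0 ≠ 0) (ht : ∀ n, t n ≠ 0) :
    GenMeans.betaDual (GenMeans.space (GenMeans.c0 𝕜) r s t) =
        GenMeans.B₁ r s t ∩ GenMeans.B₂ r s t ∩ GenMeans.B₃ r s t ∧
      GenMeans.betaDual (GenMeans.space (GenMeans.linf 𝕜) r s t) =
        GenMeans.B₁ r s t ∩ GenMeans.B₄ r s t ∧
      GenMeans.betaDual (GenMeans.space (GenMeans.c 𝕜) r s t) =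
        GenMeans.B₁ r s t ∩ GenMeans.B₃ r s t ∩ GenMeans.B₅ r s t ∩ GenMeans.B₆ r s t := by
  open GenMeans in
  refine ⟨?_, ?_, ?_⟩ <;> ext a <;> rw [mem_betaDual_space_iff hr hs ht]
  · rw [forall_c0_iff fun N => partialCoeff_of_le r s t a le_rfl, Set.inter_assoc,
      mem_B₁_inter_iff]
    refine exists_congr fun R => ?_
    rw [← isR_iff]
    refine and_congr_right fun hR => and_congr_right fun _ => ?_
    rw [Set.mem_inter_iff, mem_B₃_iff hR, and_iff_right (mem_B₂ hR)]
  · rw [forall_linf_iff fun N k => partialCoeff_of_le r s t a, mem_B₁_inter_iff]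
    refine exists_congr fun R => ?_
    rw [← isR_iff]
    refine and_congr_right fun hR => and_congr_right fun _ => ?_
    rw [mem_B₄_iff hR]
  · rw [forall_c_iff fun N => partialCoeff_of_le r s t a le_rfl, Set.inter_assoc,
      Set.inter_assoc, mem_B₁_inter_iff]
    refine exists_congr fun R => ?_
    rw [← isR_iff]
    refine and_congr_right fun hR => and_congr_right fun _ => ?_
    rw [Set.mem_inter_iff, Set.mem_inter_iff, mem_B₃_iff hR, mem_B₆_iff hR,
      and_iff_right (B₂_subset_B₅ r s t (mem_B₂ hR))]
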